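/- Let $d\in\mathbb N$ and let $\rho_1,\rho_2$ be density matrices of dimension $d$, i.e. positive semi-definite complex $d\times d$ matrices of unit trace, such that $\tfrac12\|\rho_1-\rho_2\|_1=\varepsilon$ for some $\varepsilon\in(0,1)$, where $\|A\|_1=\operatorname{Tr}\big((A^*A)^{1/2}\big)$. Write $S(\rho)=-\operatorname{Tr}(\rho\log\rho)$ for the von Neumann entropy (natural logarithm, $0\log 0=0$), $h(\varepsilon)=-\varepsilon\log\varepsilon-(1-\varepsilon)\log(1-\varepsilon)$ for the binary entropy, and $\operatorname{supp}X=(\ker X)^\perp$ for the support of a matrix $X$ acting on $\mathbb C^d$. (a) There is exactly one pair of matrices $(\rho_+,\rho_-)$ such that $\rho_1-\rho_2=\varepsilon\rho_+-\varepsilon\rho_-$ is the Jordan–Hahn decomposition of $\rho_1-\rho_2$, i.e. $\varepsilon\rho_\pm$ are positive semi-definite with mutually orthogonal supports. These $\rho_\pm$ are density matrices with mutually orthogonal supports, and $$S(\rho_1)-S(\rho_2)\le \varepsilon S(\rho_+)-\varepsilon S(\rho_-)+h(\varepsilon).$$ (b) The bound is tight: for every $d\ge 2$ and every $\varepsilon\in(0,1)$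 there are density matrices $\rho_1,\rho_2$ of dimension $d$ with $\tfrac12\|\rho_1-\rho_2\|_1=\varepsilon$ for which equality holds in (a). (c) Consequently, the Audenaert–Fannes inequality holds: for all density matrices $\rho_1,\rho_2$ of dimension $d$ with $\tfrac12\|\rho_1-\rho_2\|_1=\varepsilon\in(0,1)$, $$|S(\rho_1)-S(\rho_2)|\le \varepsilon\log(d-1)+h(\varepsilon).$$ -/

import Mathlib

open Matrix
open scoped ComplexOrder

noncomputable section

namespace QEntropy

/-- A quantum state (density matrix) of dimension `d`: a positive semi-definite complex matrix
of unit trace. -/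
def IsState {d : ℕ} (ρ : Matrix (Fin d) (Fin d) ℂ) : Prop :=
  ρ.PosSemidef ∧ ρ.trace = 1

/-- The trace norm `‖A‖₁ = Tr (A* A)^{1/2}`; the square root is taken in the continuous
functional calculus of the Hermitian matrix `A* A`. -/
def traceNorm {d : ℕ} (A : Matrix (Fin d) (Fin d) ℂ) : ℝ :=
  (cfc Real.sqrt (Aᴴ * A)).trace.re

/-- The trace distance `½ ‖ρ₁ - ρ₂‖₁`. -/
def traceDist {d : ℕ} (ρ₁ ρ₂ : Matrix (Fin d) (Fin d) ℂ) : ℝ :=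
  (1 / 2) * traceNorm (ρ₁ - ρ₂)

/-- The von Neumann entropy `S(ρ) = -Tr (ρ log ρ)`, with the natural logarithm; the logarithm is
taken in the continuous functional calculus of the Hermitian matrix `ρ`. Since `Real.log 0 = 0`,
zero eigenvalues contribute `0 log 0 = 0`, as is the convention. -/
def vonNeumannEntropy {d : ℕ} (ρ : Matrix (Fin d) (Fin d) ℂ) : ℝ :=
  -(ρ * cfc Real.log ρ).trace.re

/-- The support `(ker A)ᗮ` of a matrix acting on the Hilbert space `ℂ^d`. -/
def supp {d : ℕ} (A : Matrix (Fin d) (Fin d) ℂ) : Submodule ℂ (EuclideanSpace ℂ (Fin d)) :=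
  (LinearMap.ker (Matrix.toEuclideanLin A))ᗮ

/-- `Δ = P - N` is the Jordan–Hahn decomposition of `Δ`: `P` and `N` are positive semi-definite
with mutually orthogonal supports. -/
def IsJordanHahn {d : ℕ} (Δ P N : Matrix (Fin d) (Fin d) ℂ) : Prop :=
  Δ = P - N ∧ P.PosSemidef ∧ N.PosSemidef ∧ supp P ⟂ supp N

end QEntropy

end

/-! Put η(x) = -x log x, P = ερ₊, N = ερ₋, and let S(A) = -Tr A log A for every positive
semidefinite A. Then ρ₁ + N = ρ₂ + P with PN = 0, and since S(ερ) = εS(ρ) + η(ε) for a state ρ, the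
bound becomes S(ρ₁) + S(N) ≤ S(ρ₂) + S(P) + h(ε).

Subadditivity gives S(ρ₂ + P) ≤ S(ρ₂) + S(P). In an eigenbasis where N = diag(c), let a be the
diagonal of ρ₁. Adding N does not increase the gap ∑ η(aᵢ) - S(ρ₁) between diagonal and spectral
entropy (`vonNeumannEntropy_sub_add_diagonal_le`). What remains is the scalar bound ∑ (η(aᵢ) + η(cᵢ)
- η(aᵢ + cᵢ)) ≤ h(ε). Where cᵢ > 0, PN = 0 forces Pᵢᵢ = 0, so these aᵢ + cᵢ are diagonal entries of
ρ₂ and sum to at most 1; Gibbs' inequality with weights (1 - ε, ε) finishes.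

Both matrix inequalities are integrated over s from inequalities between log det(· + s). Those are
proved by adding one diagonal entry at a time, each multiplying the determinant by 1 + c(X⁻¹)ᵢᵢ.

For Audenaert–Fannes, ρ₊ is singular, so S(ρ₊) ≤ log(d - 1), while S(ρ₋) ≥ 0. -/

open Filter Topology in
/-- If two families of nonnegative reals have the same sum and `∑ log (x i + s) ≤ ∑ log (y i + s)`
for every `s > 0`, then `∑ -x i log x i ≤ ∑ -y i log y i`. -/
theorem sum_negMulLog_le_of_sum_log_le {κ : Type*} [Fintype κ] {x y : κ → ℝ}
    (hx : ∀ i, 0 ≤ x i) (hy : ∀ i, 0 ≤ y i) (hsum : ∑ i, x i = ∑ i, y i)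
    (hlog : ∀ s : ℝ, 0 < s → ∑ i, Real.log (x i + s) ≤ ∑ i, Real.log (y i + s)) :
    ∑ i, Real.negMulLog (x i) ≤ ∑ i, Real.negMulLog (y i) := by
  -- The hypothesis says G' ≤ 0 on (0, ∞), and equal sums give G → 0 at infinity; hence G(0) ≥ 0,
  -- which is the claim.
  set G : ℝ → ℝ := fun s =>
    ∑ i, (x i + s) * Real.log (x i + s) - ∑ i, (y i + s) * Real.log (y i + s) with hG
  have hderiv : ∀ z : κ → ℝ, (∀ i, 0 ≤ z i) → ∀ s : ℝ, 0 < s →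
      HasDerivAt (fun s => ∑ i, (z i + s) * Real.log (z i + s))
        (∑ i, (Real.log (z i + s) + 1)) s := by
    intro z hz s hs
    refine HasDerivAt.fun_sum fun i _ => ?_
    exact (Real.hasDerivAt_mul_log (x := z i + s) (by linarith [hz i])).comp_const_add (z i) s
  have hcont : Continuous G := by
    have h := Real.continuous_mul_log
    have h' : ∀ z : κ → ℝ, Continuous fun s : ℝ => ∑ i, (z i + s) * Real.log (z i + s) :=
      fun z => continuous_finsetSum _ fun i _ => h.comp (continuous_const.add continuous_id)
    exact (h' x).sub (h' y)
  have hanti : AntitoneOn G (Set.Ici 0) := by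
    refine antitoneOn_of_deriv_nonpos (convex_Ici 0) hcont.continuousOn ?_ ?_
    · intro s hs
      rw [interior_Ici] at hs
      exact ((hderiv x hx s hs).sub (hderiv y hy s hs)).differentiableAt.differentiableWithinAt
    · intro s hs
      rw [interior_Ici] at hs
      have h : HasDerivAt G _ s := (hderiv x hx s hs).sub (hderiv y hy s hs)
      rw [h.deriv]
      simp only [Finset.sum_add_distrib]
      linarith [hlog s hs]
  -- The difference equals c log(1 + c/s) + s log(1 + c/s). The subtracted terms (c + s) log s have
  -- the same total for both families, so they cancel in G.
  have hterm : ∀ c : ℝ, 0 ≤ c →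
      Tendsto (fun s : ℝ => (c + s) * Real.log (c + s) - (c + s) * Real.log s) atTop (𝓝 c) := by
    intro c hc
    have h1 := Real.tendsto_mul_log_one_add_div_atTop c
    have h2 : Tendsto (fun s : ℝ => c * Real.log (1 + c / s)) atTop (𝓝 0) := by
      have h3 : Tendsto (fun s : ℝ => 1 + c / s) atTop (𝓝 1) := by
        simpa using (tendsto_const_nhds (x := (1 : ℝ))).add
          ((tendsto_const_nhds (x := c)).div_atTop tendsto_id)
      simpa using (h3.log one_ne_zero).const_mul c
    have h4 := h2.add h1
    rw [zero_add] at h4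
    refine h4.congr' ?_
    filter_upwards [eventually_gt_atTop 0] with s hs
    have : 1 + c / s = (c + s) / s := by field_simp; ring
    rw [this, Real.log_div (by positivity) hs.ne']
    ring
  have hlim : Tendsto G atTop (𝓝 0) := by
    have h := (tendsto_finsetSum Finset.univ fun i _ => hterm (x i) (hx i)).sub
      (tendsto_finsetSum Finset.univ fun i _ => hterm (y i) (hy i))
    rw [hsum, sub_self] at h
    refine h.congr fun s => ?_
    simp only [hG, Finset.sum_sub_distrib, ← Finset.sum_mul, Finset.sum_add_distrib, hsum]
    ring
  have h0 : 0 ≤ G 0 := by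
    refine le_of_tendsto hlim ?_
    filter_upwards [eventually_ge_atTop 0] with s hs
    exact hanti (Set.mem_Ici.2 le_rfl) hs hs
  simp only [hG, add_zero, sub_nonneg] at h0
  simp only [Real.negMulLog, neg_mul, Finset.sum_neg_distrib]
  linarith

/-! ### Determinants under diagonal perturbations -/

namespace Matrix

variable {n : Type*} [Fintype n] [DecidableEq n]

theorem PosDef.one_le_diag_mul_inv_diag {X : Matrix n n ℂ} (hX : X.PosDef) (i : n) :
    0 < (X⁻¹ i i).re ∧ 1 ≤ (X i i).re * (X⁻¹ i i).re := by
  have hinv := hX.inv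
  have hv : 0 < (X⁻¹ i i).re := (Complex.pos_iff.1 hinv.diag_pos).1
  refine ⟨hv, ?_⟩
  -- With v = (X⁻¹)ᵢᵢ, the i-th diagonal entry of (tX⁻¹ - 1)X(tX⁻¹ - 1) ≥ 0 is t²v - 2t + Xᵢᵢ,
  -- minimized at t = 1/v.
  set t : ℝ := ((X⁻¹ i i).re)⁻¹ with ht
  have hu : IsUnit X.det := (Matrix.isUnit_iff_isUnit_det _).1 hX.isUnit
  have hD : (((t : ℂ) • X⁻¹ - 1 : Matrix n n ℂ)ᴴ) = (t : ℂ) • X⁻¹ - 1 := by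
    simp [hX.isHermitian.eq, conjTranspose_nonsing_inv]
  have h := (hX.posSemidef.conjTranspose_mul_mul_same ((t : ℂ) • X⁻¹ - 1)).diag_nonneg (i := i)
  have he : ((t : ℂ) • X⁻¹ - 1 : Matrix n n ℂ) * X * ((t : ℂ) • X⁻¹ - 1)
      = ((t : ℂ) ^ 2) • X⁻¹ - (2 * t : ℂ) • 1 + X := by
    simp only [sub_mul, mul_sub, smul_mul_assoc, mul_smul_comm, nonsing_inv_mul _ hu, one_mul,
      mul_one, mul_nonsing_inv _ hu, smul_sub, smul_smul]
    rw [two_mul, add_smul, sq]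
    abel
  rw [hD, he] at h
  have h' := (Complex.nonneg_iff.1 h).1
  simp [sq] at h'
  have h1 : t * (X⁻¹ i i).re = 1 := inv_mul_cancel₀ hv.ne'
  have h2 : t ≤ (X i i).re := by nlinarith
  calc 1 = t * (X⁻¹ i i).re := h1.symm
    _ ≤ _ := by gcongr

/-- With X = A + s, positivity of X⁻¹AX⁻¹ = X⁻¹ - sX⁻² and (X⁻²)ᵢᵢ ≥ ((X⁻¹)ᵢᵢ)² give sv² ≤ v for v =
(X⁻¹)ᵢᵢ. -/
theorem PosSemidef.inv_add_smul_one_diag_le {A : Matrix n n ℂ} (hA : A.PosSemidef) {s : ℝ}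
    (hs : 0 < s) (i : n) : ((A + (s : ℂ) • 1)⁻¹ i i).re ≤ 1 / s := by
  have hX : (A + (s : ℂ) • 1).PosDef :=
    PosDef.posSemidef_add hA (PosDef.one.smul (by simpa using hs))
  set X := A + (s : ℂ) • 1 with hXdef
  have hv := (hX.one_le_diag_mul_inv_diag i).1
  have hu : IsUnit X.det := (Matrix.isUnit_iff_isUnit_det _).1 hX.isUnit
  have hH : (X⁻¹)ᴴ = X⁻¹ := hX.inv.isHermitian
  have h := (hA.conjTranspose_mul_mul_same X⁻¹).diag_nonneg (i := i)
  have he : (X⁻¹)ᴴ * A * X⁻¹ = X⁻¹ - (s : ℂ) • (X⁻¹ * (X⁻¹)ᴴ) := by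
    have : A = X - (s : ℂ) • 1 := by simp [hXdef]
    rw [hH, this]
    simp [sub_mul, mul_sub, nonsing_inv_mul _ hu]
  rw [he] at h
  have h' := (Complex.nonneg_iff.1 h).1
  have hsum : (X⁻¹ i i).re ^ 2 ≤ ((X⁻¹ * (X⁻¹)ᴴ) i i).re := by
    rw [mul_apply, Complex.re_sum]
    refine le_trans ?_ (Finset.single_le_sum (f := fun j => (X⁻¹ i j * (X⁻¹)ᴴ j i).re)
      (fun j _ => ?_) (Finset.mem_univ i))
    · simp [sq]; nlinarith [mul_self_nonneg (X⁻¹ i i).im]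
    · simp; nlinarith [mul_self_nonneg (X⁻¹ i j).im, mul_self_nonneg (X⁻¹ i j).re]
  simp at h'
  rw [le_div_iff₀ hs]
  have : s * (X⁻¹ i i).re ^ 2 ≤ (X⁻¹ i i).re := by nlinarith
  nlinarith

theorem PosDef.re_det_pos {X : Matrix n n ℂ} (hX : X.PosDef) : 0 < X.det.re :=
  (Complex.pos_iff.1 hX.det_pos).1

theorem PosDef.re_det_add_single {X : Matrix n n ℂ} (hX : X.PosDef) (i : n) (c : ℝ) :
    (X + Matrix.diagonal (Pi.single i (c : ℂ))).det.re
      = X.det.re * (1 + c * (X⁻¹ i i).re) := by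
  have hu : IsUnit X.det := (Matrix.isUnit_iff_isUnit_det _).1 hX.isUnit
  have he : Matrix.diagonal (Pi.single i (c : ℂ))
      = replicateCol Unit (Pi.single i (c : ℂ)) * replicateRow Unit (Pi.single i (1 : ℂ)) := by
    ext j k
    simp only [mul_apply, replicateCol_apply, replicateRow_apply, diagonal_apply, Pi.single_apply]
    by_cases h1 : j = k <;> by_cases h2 : j = i <;> by_cases h3 : k = i <;> simp_all
  rw [he, det_add_replicateCol_mul_replicateRow hu]
  have h1 : (replicateRow Unit (Pi.single i (1 : ℂ)) * X⁻¹ * replicateCol Unit (Pi.single i (c : ℂ)))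
      = (X⁻¹ i i * c) • (1 : Matrix Unit Unit ℂ) := by
    ext j k
    simp [mul_apply, Pi.single_apply]
  rw [h1, det_unique (n := Unit)]
  have h2 : X.det.im = 0 := (Complex.pos_iff.1 hX.det_pos).2.symm
  simp [h2]
  ring_nf
  simp

/-- Adding a nonnegative diagonal matrix to a positive definite matrix increases the ratio of the
determinant to the product of the diagonal entries. -/
theorem PosDef.log_det_add_sum_log_le {X : Matrix n n ℂ} (hX : X.PosDef) {c : n → ℝ}
    (hc : ∀ i, 0 ≤ c i) :
    Real.log X.det.re + ∑ i, Real.log ((X i i).re + c i)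
      ≤ Real.log (X + diagonal fun i => (c i : ℂ)).det.re + ∑ i, Real.log (X i i).re := by
  have key : ∀ T : Finset n, Real.log X.det.re + ∑ i ∈ T, Real.log ((X i i).re + c i)
      ≤ Real.log (X + diagonal fun i => if i ∈ T then (c i : ℂ) else 0).det.re
        + ∑ i ∈ T, Real.log (X i i).re := by
    intro T
    induction T using Finset.induction_on with
    | empty => simp
    | insert j T hj ih =>
      rw [Finset.sum_insert hj, Finset.sum_insert hj]
      set Y := X + diagonal fun i => if i ∈ T then (c i : ℂ) else 0 with hY
      have hYp : Y.PosDef := by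
        refine hX.add_posSemidef (PosSemidef.diagonal fun i => ?_)
        simp only [Pi.zero_apply]
        split_ifs
        · simpa using hc i
        · exact le_rfl
      have he : (X + diagonal fun i => if i ∈ insert j T then (c i : ℂ) else 0)
          = Y + diagonal (Pi.single j (c j : ℂ)) := by
        rw [hY, add_assoc, diagonal_add]
        congr 2
        ext i
        by_cases h : i = j
        · subst h; simp [hj]
        · simp [h]
      -- Entry j is still untouched, so Xⱼⱼ(Y⁻¹)ⱼⱼ ≥ 1, whence Xⱼⱼ + cⱼ ≤ Xⱼⱼ(1 + cⱼ(Y⁻¹)ⱼⱼ).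
      have hd : Y j j = X j j := by simp [hY, hj]
      obtain ⟨hv, hxv⟩ := hYp.one_le_diag_mul_inv_diag j
      have hx := (Complex.pos_iff.1 (hX.diag_pos (i := j))).1
      have hcj := hc j
      rw [he, hYp.re_det_add_single, Real.log_mul hYp.re_det_pos.ne' (by positivity)]
      have : Real.log ((X j j).re + c j)
          ≤ Real.log (1 + c j * (Y⁻¹ j j).re) + Real.log (X j j).re := by
        rw [← Real.log_mul (by positivity) hx.ne']
        apply Real.log_le_log (by positivity)
        rw [hd] at hxv
        nlinarith
      linarith
  simpa using key Finset.univ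

/-- Log-determinant form of subadditivity: each diagonal update multiplies the determinant by at
most 1 + c/s. The terms log s account for zero eigenvalues used later as padding. -/
theorem PosSemidef.log_det_add_le {A : Matrix n n ℂ} (hA : A.PosSemidef) {c : n → ℝ}
    (hc : ∀ i, 0 ≤ c i) {s : ℝ} (hs : 0 < s) :
    Real.log (A + (diagonal fun i => (c i : ℂ)) + (s : ℂ) • 1).det.re + ∑ _i : n, Real.log s
      ≤ Real.log (A + (s : ℂ) • 1).det.re + ∑ i, Real.log (c i + s) := by
  have key : ∀ T : Finset n,
      Real.log (A + (diagonal fun i => if i ∈ T then (c i : ℂ) else 0) + (s : ℂ) • 1).det.re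
          + ∑ _i ∈ T, Real.log s
        ≤ Real.log (A + (s : ℂ) • 1).det.re + ∑ i ∈ T, Real.log (c i + s) := by
    intro T
    induction T using Finset.induction_on with
    | empty => simp
    | insert j T hj ih =>
      rw [Finset.sum_insert hj, Finset.sum_insert hj]
      set B := A + diagonal fun i => if i ∈ T then (c i : ℂ) else 0 with hB
      have hBp : B.PosSemidef := by
        refine hA.add (PosSemidef.diagonal fun i => ?_)
        simp only [Pi.zero_apply]
        split_ifs
        · simpa using hc i
        · exact le_rfl
      have hYp : (B + (s : ℂ) • 1).PosDef :=
        PosDef.posSemidef_add hBp (PosDef.one.smul (by simpa using hs))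
      have he : (A + (diagonal fun i => if i ∈ insert j T then (c i : ℂ) else 0) + (s : ℂ) • 1)
          = (B + (s : ℂ) • 1) + diagonal (Pi.single j (c j : ℂ)) := by
        rw [hB, add_right_comm _ _ (diagonal (Pi.single j (c j : ℂ))), add_assoc A _ (diagonal _),
          diagonal_add]
        congr 3
        ext i
        by_cases h : i = j
        · subst h; simp [hj]
        · simp [h]
      have hv := (hYp.one_le_diag_mul_inv_diag j).1
      have hvs := hBp.inv_add_smul_one_diag_le hs j
      have hcj := hc j
      rw [he, hYp.re_det_add_single, Real.log_mul hYp.re_det_pos.ne' (by positivity)]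
      have : Real.log (1 + c j * ((B + (s : ℂ) • 1)⁻¹ j j).re) + Real.log s
          ≤ Real.log (c j + s) := by
        rw [← Real.log_mul (by positivity) hs.ne']
        apply Real.log_le_log (by positivity)
        rw [le_div_iff₀ hs] at hvs
        nlinarith
      linarith
  simpa using key Finset.univ

end Matrix

/-! ### Functional calculus in an arbitrary eigenbasis -/

namespace Matrix

variable {n : Type*} [Fintype n] [DecidableEq n]

theorem cfc_mul_diagonal_mul_conjTranspose {U : Matrix n n ℂ} (hU : U ∈ unitaryGroup n ℂ)
    (x : n → ℝ) (f : ℝ → ℝ) :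
    cfc f (U * (diagonal fun i => (x i : ℂ)) * Uᴴ) = U * (diagonal fun i => (f (x i) : ℂ)) * Uᴴ := by
  have hU1 : Uᴴ * U = 1 := mem_unitaryGroup_iff'.1 hU
  have hU2 : U * Uᴴ = 1 := mem_unitaryGroup_iff.1 hU
  set A := U * (diagonal fun i => (x i : ℂ)) * Uᴴ with hAdef
  have hA : A.IsHermitian := by
    refine isHermitian_mul_mul_conjTranspose _ (isHermitian_diagonal_of_self_adjoint _ ?_)
    ext i; simp
  set V : Matrix n n ℂ := (hA.eigenvectorUnitary : unitaryGroup n ℂ).1 with hV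
  have hV1 : Vᴴ * V = 1 := mem_unitaryGroup_iff'.1 hA.eigenvectorUnitary.2
  have hV2 : V * Vᴴ = 1 := mem_unitaryGroup_iff.1 hA.eigenvectorUnitary.2
  have hspec : A = V * (diagonal fun i => (hA.eigenvalues i : ℂ)) * Vᴴ := hA.spectral_theorem
  have hcfc : cfc f A = V * (diagonal fun i => (f (hA.eigenvalues i) : ℂ)) * Vᴴ := by
    rw [hA.cfc_eq]; rfl
  have hint : (Uᴴ * V) * (diagonal fun i => (hA.eigenvalues i : ℂ))
      = (diagonal fun i => (x i : ℂ)) * (Uᴴ * V) := by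
    have h := hspec.symm.trans hAdef
    calc (Uᴴ * V) * (diagonal fun i => (hA.eigenvalues i : ℂ))
        = Uᴴ * (V * (diagonal fun i => (hA.eigenvalues i : ℂ)) * Vᴴ) * V := by
          simp only [Matrix.mul_assoc, hV1, Matrix.mul_one]
      _ = (Uᴴ * U) * (diagonal fun i => (x i : ℂ)) * (Uᴴ * V) := by
          rw [h]; simp only [Matrix.mul_assoc]
      _ = _ := by rw [hU1, Matrix.one_mul]
  -- The intertwiner UᴴV has nonzero entries only between equal eigenvalues, so it also intertwines
  -- their images under f.
  have hint' : (Uᴴ * V) * (diagonal fun i => (f (hA.eigenvalues i) : ℂ))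
      = (diagonal fun i => (f (x i) : ℂ)) * (Uᴴ * V) := by
    ext i j
    have h := congrFun (congrFun hint i) j
    simp only [mul_diagonal, diagonal_mul] at h ⊢
    by_cases hz : (Uᴴ * V) i j = 0
    · simp [hz]
    · rw [mul_comm] at h
      have h2 : hA.eigenvalues j = x i := by exact_mod_cast mul_right_cancel₀ hz h
      rw [h2, mul_comm]
  calc cfc f A = U * ((Uᴴ * V) * (diagonal fun i => (f (hA.eigenvalues i) : ℂ))) * Vᴴ := by
        rw [hcfc, ← Matrix.mul_assoc, ← Matrix.mul_assoc, hU2, Matrix.one_mul]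
    _ = U * (diagonal fun i => (f (x i) : ℂ)) * Uᴴ * (V * Vᴴ) := by
        rw [hint']; simp only [Matrix.mul_assoc]
    _ = _ := by rw [hV2, Matrix.mul_one]

theorem PosSemidef.exists_eq_mul_diagonal_mul {A : Matrix n n ℂ} (hA : A.PosSemidef) :
    ∃ U ∈ unitaryGroup n ℂ, ∃ x : n → ℝ, (∀ i, 0 ≤ x i) ∧
      A = U * (diagonal fun i => (x i : ℂ)) * Uᴴ :=
  ⟨hA.isHermitian.eigenvectorUnitary, hA.isHermitian.eigenvectorUnitary.2, _,
    hA.eigenvalues_nonneg, hA.isHermitian.spectral_theorem⟩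

theorem trace_mul_mul_conjTranspose {U : Matrix n n ℂ} (hU : U ∈ unitaryGroup n ℂ)
    (A : Matrix n n ℂ) : (U * A * Uᴴ).trace = A.trace := by
  have hU1 : Uᴴ * U = 1 := mem_unitaryGroup_iff'.1 hU
  rw [trace_mul_comm, ← Matrix.mul_assoc, hU1, Matrix.one_mul]

theorem re_det_add_smul_one {U : Matrix n n ℂ} (hU : U ∈ unitaryGroup n ℂ) (x : n → ℝ) (s : ℝ) :
    (U * (diagonal fun i => (x i : ℂ)) * Uᴴ + (s : ℂ) • 1).det.re = ∏ i, (x i + s) := by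
  have hU2 : U * Uᴴ = 1 := mem_unitaryGroup_iff.1 hU
  have he : U * (diagonal fun i => (x i : ℂ)) * Uᴴ + (s : ℂ) • 1
      = U * (diagonal fun i => ((x i + s : ℝ) : ℂ)) * Uᴴ := by
    have : (diagonal fun i => ((x i + s : ℝ) : ℂ))
        = (diagonal fun i => (x i : ℂ)) + (s : ℂ) • (1 : Matrix n n ℂ) := by
      rw [smul_one_eq_diagonal, diagonal_add]; simp
    rw [this, Matrix.mul_add, Matrix.add_mul]
    simp [hU2]
  rw [he, det_mul_right_comm, hU2, Matrix.one_mul, det_diagonal, ← Complex.ofReal_prod,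
    Complex.ofReal_re]

end Matrix

/-! ### Entropy inequalities for diagonal perturbations -/

namespace QEntropy

variable {d : ℕ}

theorem vonNeumannEntropy_mul_diagonal_mul {U : Matrix (Fin d) (Fin d) ℂ}
    (hU : U ∈ unitaryGroup (Fin d) ℂ) (x : Fin d → ℝ) :
    vonNeumannEntropy (U * (diagonal fun i => (x i : ℂ)) * Uᴴ) = ∑ i, Real.negMulLog (x i) := by
  have hU1 : Uᴴ * U = 1 := mem_unitaryGroup_iff'.1 hU
  rw [vonNeumannEntropy, cfc_mul_diagonal_mul_conjTranspose hU]
  have : U * (diagonal fun i => (x i : ℂ)) * Uᴴ * (U * (diagonal fun i => (Real.log (x i) : ℂ)) * Uᴴ)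
      = U * (diagonal fun i => ((x i * Real.log (x i) : ℝ) : ℂ)) * Uᴴ := by
    calc _ = U * (diagonal fun i => (x i : ℂ)) * (Uᴴ * U) *
          (diagonal fun i => (Real.log (x i) : ℂ)) * Uᴴ := by simp only [Matrix.mul_assoc]
      _ = _ := by rw [hU1, Matrix.mul_one, Matrix.mul_assoc U, diagonal_mul_diagonal]; simp
  rw [this, trace_mul_mul_conjTranspose hU, trace_diagonal, ← Complex.ofReal_sum,
    Complex.ofReal_re, ← Finset.sum_neg_distrib]
  simp [Real.negMulLog]

theorem vonNeumannEntropy_diagonal (x : Fin d → ℝ) :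
    vonNeumannEntropy (diagonal fun i => (x i : ℂ)) = ∑ i, Real.negMulLog (x i) := by
  simpa using vonNeumannEntropy_mul_diagonal_mul (one_mem (unitaryGroup (Fin d) ℂ)) x

theorem vonNeumannEntropy_conj {V : Matrix (Fin d) (Fin d) ℂ} (hV : V ∈ unitaryGroup (Fin d) ℂ)
    {A : Matrix (Fin d) (Fin d) ℂ} (hA : A.PosSemidef) :
    vonNeumannEntropy (V * A * Vᴴ) = vonNeumannEntropy A := by
  obtain ⟨U, hU, x, -, rfl⟩ := hA.exists_eq_mul_diagonal_mul
  have := vonNeumannEntropy_mul_diagonal_mul (mul_mem hV hU) x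
  rw [vonNeumannEntropy_mul_diagonal_mul hU, ← this, conjTranspose_mul]
  simp only [Matrix.mul_assoc]

/-- The data of the spectrum needed to compare entropies: the entropy, trace and characteristic
determinants of a positive semidefinite matrix in terms of its eigenvalues. -/
theorem exists_spectrum {A : Matrix (Fin d) (Fin d) ℂ} (hA : A.PosSemidef) :
    ∃ x : Fin d → ℝ, (∀ i, 0 ≤ x i) ∧ vonNeumannEntropy A = ∑ i, Real.negMulLog (x i) ∧
      ∑ i, x i = A.trace.re ∧
      ∀ s : ℝ, 0 < s → Real.log (A + (s : ℂ) • 1).det.re = ∑ i, Real.log (x i + s) := by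
  obtain ⟨U, hU, x, hx, rfl⟩ := hA.exists_eq_mul_diagonal_mul
  refine ⟨x, hx, vonNeumannEntropy_mul_diagonal_mul hU x, ?_, fun s hs => ?_⟩
  · rw [trace_mul_mul_conjTranspose hU, trace_diagonal, ← Complex.ofReal_sum, Complex.ofReal_re]
  · rw [re_det_add_smul_one hU, Real.log_prod]
    intro i _
    linarith [hx i]

theorem vonNeumannEntropy_add_diagonal_le {A : Matrix (Fin d) (Fin d) ℂ} (hA : A.PosSemidef)
    {c : Fin d → ℝ} (hc : ∀ i, 0 ≤ c i) :
    vonNeumannEntropy (A + diagonal fun i => (c i : ℂ))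
      ≤ vonNeumannEntropy A + ∑ i, Real.negMulLog (c i) := by
  have hD : (diagonal fun i => (c i : ℂ)).PosSemidef :=
    PosSemidef.diagonal fun i => by simpa using hc i
  obtain ⟨x, hx, hSx, htx, hlx⟩ := exists_spectrum hA
  obtain ⟨y, hy, hSy, hty, hly⟩ := exists_spectrum (hA.add hD)
  -- Zeros contribute no entropy but make both families indexed by two copies of `Fin d`.
  have h := sum_negMulLog_le_of_sum_log_le (x := Sum.elim y fun _ : Fin d => (0 : ℝ))
    (y := Sum.elim x c) (by simp [hy]) (by simp [hx, hc]) (by simp [htx, hty]) fun s hs => by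
      have := hA.log_det_add_le hc hs
      rw [hly s hs, hlx s hs] at this
      simpa using this
  simpa [hSx, hSy] using h

theorem vonNeumannEntropy_sub_add_diagonal_le {A : Matrix (Fin d) (Fin d) ℂ} (hA : A.PosSemidef)
    {c : Fin d → ℝ} (hc : ∀ i, 0 ≤ c i) :
    vonNeumannEntropy A + ∑ i, Real.negMulLog ((A i i).re + c i)
      ≤ vonNeumannEntropy (A + diagonal fun i => (c i : ℂ)) + ∑ i, Real.negMulLog (A i i).re := by
  have hD : (diagonal fun i => (c i : ℂ)).PosSemidef :=
    PosSemidef.diagonal fun i => by simpa using hc i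
  have ha : ∀ i, 0 ≤ (A i i).re := fun i => (Complex.nonneg_iff.1 hA.diag_nonneg).1
  obtain ⟨x, hx, hSx, htx, hlx⟩ := exists_spectrum hA
  obtain ⟨y, hy, hSy, hty, hly⟩ := exists_spectrum (hA.add hD)
  have h := sum_negMulLog_le_of_sum_log_le (x := Sum.elim x fun i => (A i i).re + c i)
    (y := Sum.elim y fun i => (A i i).re) (by simp [hx, ha, add_nonneg, hc]) (by simp [hy, ha])
    (by simp [htx, hty, Finset.sum_add_distrib, trace]; ring) fun s hs => by
      have hX : (A + (s : ℂ) • 1).PosDef :=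
        PosDef.posSemidef_add hA (PosDef.one.smul (by simpa using hs))
      have := hX.log_det_add_sum_log_le hc
      rw [add_right_comm A, hly s hs, hlx s hs] at this
      simpa [add_right_comm _ s] using this
  simpa [hSx, hSy] using h

end QEntropy

/-! ### The entropy bound -/

/-- Gibbs' inequality: the left side is (a + c)h(c/(a + c)), and the right side is the cross entropy
against (1 - q, q). -/
theorem negMulLog_add_negMulLog_sub_le {a c q : ℝ} (ha : 0 ≤ a) (hc : 0 < c) (hq₀ : 0 < q)
    (hq₁ : q < 1) :
    Real.negMulLog a + Real.negMulLog c - Real.negMulLog (a + c)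
      ≤ -(a * Real.log (1 - q)) - c * Real.log q := by
  have hq : 0 < 1 - q := by linarith
  rcases ha.eq_or_lt with rfl | ha
  · have := mul_nonneg hc.le (neg_nonneg.2 (Real.log_nonpos hq₀.le hq₁.le))
    simp only [Real.negMulLog_zero, zero_add, zero_mul, neg_zero, sub_self]
    linarith
  have h1 := mul_le_mul_of_nonneg_left
    (Real.log_le_sub_one_of_pos (x := (a + c) * (1 - q) / a) (by positivity)) ha.le
  have h2 := mul_le_mul_of_nonneg_left
    (Real.log_le_sub_one_of_pos (x := (a + c) * q / c) (by positivity)) hc.le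
  rw [Real.log_div (by positivity) ha.ne', Real.log_mul (by positivity) hq.ne'] at h1
  rw [Real.log_div (by positivity) hc.ne', Real.log_mul (by positivity) hq₀.ne'] at h2
  have e1 : a * ((a + c) * (1 - q) / a - 1) = (a + c) * (1 - q) - a := by field_simp
  have e2 : c * ((a + c) * q / c - 1) = (a + c) * q - c := by field_simp
  rw [e1] at h1
  rw [e2] at h2
  simp only [Real.negMulLog]
  nlinarith

namespace QEntropy

variable {d : ℕ}

theorem vonNeumannEntropy_add_le {A B : Matrix (Fin d) (Fin d) ℂ} (hA : A.PosSemidef)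
    (hB : B.PosSemidef) :
    vonNeumannEntropy (A + B) ≤ vonNeumannEntropy A + vonNeumannEntropy B := by
  obtain ⟨V, hV, c, hc, rfl⟩ := hB.exists_eq_mul_diagonal_mul
  have hV' : Vᴴ ∈ unitaryGroup (Fin d) ℂ := Unitary.star_mem hV
  have hV2 : V * Vᴴ = 1 := mem_unitaryGroup_iff.1 hV
  have hA' : (Vᴴ * A * V).PosSemidef := hA.conjTranspose_mul_mul_same V
  have hD : (diagonal fun i => (c i : ℂ)).PosSemidef :=
    PosSemidef.diagonal fun i => by simpa using hc i
  have h := vonNeumannEntropy_add_diagonal_le hA' hc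
  have he : V * (Vᴴ * A * V + diagonal fun i => (c i : ℂ)) * Vᴴ
      = A + V * (diagonal fun i => (c i : ℂ)) * Vᴴ := by
    rw [Matrix.mul_add, Matrix.add_mul]
    congr 1
    calc V * (Vᴴ * A * V) * Vᴴ = (V * Vᴴ) * A * (V * Vᴴ) := by simp only [Matrix.mul_assoc]
      _ = A := by rw [hV2, Matrix.one_mul, Matrix.mul_one]
  rw [← vonNeumannEntropy_conj hV (hA'.add hD), he] at h
  have h2 := vonNeumannEntropy_conj hV' hA
  rw [conjTranspose_conjTranspose] at h2
  rw [h2] at h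
  rwa [vonNeumannEntropy_mul_diagonal_mul hV]

theorem entropy_bound_of_diagonal {A B P : Matrix (Fin d) (Fin d) ℂ} {c : Fin d → ℝ} {ε : ℝ}
    (hε₀ : 0 < ε) (hε₁ : ε < 1) (hA : A.PosSemidef) (hB : B.PosSemidef) (hP : P.PosSemidef)
    (hc : ∀ i, 0 ≤ c i) (hsum : A + (diagonal fun i => (c i : ℂ)) = B + P)
    (hPc : P * (diagonal fun i => (c i : ℂ)) = 0) (hBtr : B.trace.re = 1) (hctr : ∑ i, c i = ε) :
    vonNeumannEntropy A + ∑ i, Real.negMulLog (c i)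
      ≤ vonNeumannEntropy B + vonNeumannEntropy P + Real.binEntropy ε := by
  have h1 := vonNeumannEntropy_sub_add_diagonal_le hA hc
  have h2 := vonNeumannEntropy_add_le hB hP
  rw [hsum] at h1
  have ha : ∀ i, 0 ≤ (A i i).re := fun i => (Complex.nonneg_iff.1 hA.diag_nonneg).1
  have hb : ∀ i, 0 ≤ (B i i).re := fun i => (Complex.nonneg_iff.1 hB.diag_nonneg).1
  -- Restricting to the support of c is essential: only there does PN = 0 kill Pᵢᵢ and give ∑ aᵢ ≤ 1
  -- - ε; elsewhere the summand vanishes.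
  set T := Finset.univ.filter fun i => c i ≠ 0 with hT
  have hdiag : ∀ i ∈ T, (A i i).re + c i = (B i i).re := by
    intro i hi
    have hci : c i ≠ 0 := (Finset.mem_filter.1 hi).2
    have hp : P i i = 0 := by
      have h := congrFun (congrFun hPc i) i
      rw [mul_diagonal] at h
      exact (mul_eq_zero.1 h).resolve_right (by exact_mod_cast hci)
    have h := congrArg Complex.re (congrFun (congrFun hsum i) i)
    simpa [hp] using h
  have hcT : ∑ i ∈ T, c i = ε := by rw [← hctr, hT, Finset.sum_filter_ne_zero]
  have haT : ∑ i ∈ T, (A i i).re ≤ 1 - ε := by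
    have h : ∑ i ∈ T, (B i i).re ≤ 1 := by
      rw [← hBtr, trace, Complex.re_sum]
      exact Finset.sum_le_univ_sum_of_nonneg hb
    rw [← Finset.sum_congr rfl hdiag, Finset.sum_add_distrib, hcT] at h
    linarith
  have h3 : ∑ i, (Real.negMulLog (A i i).re + Real.negMulLog (c i)
      - Real.negMulLog ((A i i).re + c i)) ≤ Real.binEntropy ε := by
    rw [← Finset.sum_subset (Finset.subset_univ T)
      (fun i _ hi => by
        have : c i = 0 := by simpa [hT] using hi
        simp [this])]
    calc _ ≤ ∑ i ∈ T, (-((A i i).re * Real.log (1 - ε)) - c i * Real.log ε) := by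
          refine Finset.sum_le_sum fun i hi => negMulLog_add_negMulLog_sub_le (ha i) ?_ hε₀ hε₁
          exact lt_of_le_of_ne (hc i) (Finset.mem_filter.1 hi).2.symm
      _ = (∑ i ∈ T, (A i i).re) * -Real.log (1 - ε) - ε * Real.log ε := by
          rw [Finset.sum_sub_distrib, ← Finset.sum_mul, hcT, Finset.sum_neg_distrib,
            ← Finset.sum_mul]
          ring
      _ ≤ (1 - ε) * -Real.log (1 - ε) - ε * Real.log ε := by
          have : 0 ≤ -Real.log (1 - ε) :=
            neg_nonneg.2 (Real.log_nonpos (by linarith) (by linarith))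
          gcongr
      _ = Real.binEntropy ε := by
          rw [Real.binEntropy, Real.log_inv, Real.log_inv]
          ring
  simp only [Finset.sum_sub_distrib, Finset.sum_add_distrib] at h3
  linarith

theorem entropy_bound_of_add_eq_add {A B P N : Matrix (Fin d) (Fin d) ℂ} {ε : ℝ}
    (hε₀ : 0 < ε) (hε₁ : ε < 1) (hA : A.PosSemidef) (hB : B.PosSemidef) (hP : P.PosSemidef)
    (hN : N.PosSemidef) (hsum : A + N = B + P) (hPN : P * N = 0) (hBtr : B.trace.re = 1)
    (hNtr : N.trace.re = ε) :
    vonNeumannEntropy A + vonNeumannEntropy N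
      ≤ vonNeumannEntropy B + vonNeumannEntropy P + Real.binEntropy ε := by
  obtain ⟨V, hV, c, hc, rfl⟩ := hN.exists_eq_mul_diagonal_mul
  have hV' : Vᴴ ∈ unitaryGroup (Fin d) ℂ := Unitary.star_mem hV
  have hV1 : Vᴴ * V = 1 := mem_unitaryGroup_iff'.1 hV
  have hconj : ∀ {X : Matrix (Fin d) (Fin d) ℂ}, X.PosSemidef →
      vonNeumannEntropy (Vᴴ * X * V) = vonNeumannEntropy X := fun {X} hX => by
    simpa using vonNeumannEntropy_conj hV' hX
  have hcancel : Vᴴ * (V * (diagonal fun i => (c i : ℂ)) * Vᴴ) * V = diagonal fun i => (c i : ℂ) := by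
    calc _ = (Vᴴ * V) * (diagonal fun i => (c i : ℂ)) * (Vᴴ * V) := by
          simp only [Matrix.mul_assoc]
      _ = _ := by rw [hV1, Matrix.one_mul, Matrix.mul_one]
  have h := entropy_bound_of_diagonal hε₀ hε₁ (hA.conjTranspose_mul_mul_same V)
    (hB.conjTranspose_mul_mul_same V) (hP.conjTranspose_mul_mul_same V) hc
    (by rw [← Matrix.add_mul, ← Matrix.mul_add, ← hsum, Matrix.mul_add, Matrix.add_mul, hcancel])
    (by
      calc Vᴴ * P * V * (diagonal fun i => (c i : ℂ))
          = Vᴴ * (P * (V * (diagonal fun i => (c i : ℂ)) * Vᴴ)) * V := by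
            simp only [Matrix.mul_assoc, hV1, Matrix.mul_one]
        _ = 0 := by rw [hPN, Matrix.mul_zero, Matrix.zero_mul])
    (by rw [← hBtr]; simpa using congrArg Complex.re (trace_mul_mul_conjTranspose hV' B))
    (by rw [← hNtr, trace_mul_mul_conjTranspose hV, trace_diagonal, ← Complex.ofReal_sum,
          Complex.ofReal_re])
  rwa [hconj hA, hconj hB, hconj hP, ← vonNeumannEntropy_mul_diagonal_mul hV c] at h

theorem vonNeumannEntropy_smul {ρ : Matrix (Fin d) (Fin d) ℂ} (hρ : ρ.PosSemidef) (ε : ℝ) :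
    vonNeumannEntropy (ε • ρ) = ε * vonNeumannEntropy ρ + ρ.trace.re * Real.negMulLog ε := by
  obtain ⟨U, hU, x, hx, rfl⟩ := hρ.exists_eq_mul_diagonal_mul
  have he : ε • (U * (diagonal fun i => (x i : ℂ)) * Uᴴ)
      = U * (diagonal fun i => ((ε * x i : ℝ) : ℂ)) * Uᴴ := by
    rw [← Matrix.smul_mul, ← Matrix.mul_smul]
    congr 2
    ext i j
    by_cases h : i = j <;> simp [h]
  rw [he, vonNeumannEntropy_mul_diagonal_mul hU, vonNeumannEntropy_mul_diagonal_mul hU,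
    trace_mul_mul_conjTranspose hU, trace_diagonal, ← Complex.ofReal_sum, Complex.ofReal_re]
  simp only [Real.negMulLog_mul, Finset.sum_add_distrib, Finset.mul_sum, Finset.sum_mul]
  rw [add_comm]

/-! ### The Jordan–Hahn decomposition -/

theorem supp_isOrtho_iff {P N : Matrix (Fin d) (Fin d) ℂ} (hN : N.IsHermitian) : supp P ⟂ supp N ↔ P * N = 0 := by
  have hmem : ∀ {X : Matrix (Fin d) (Fin d) ℂ}, X.IsHermitian →
      supp X = LinearMap.range (toEuclideanLin X) := by
    intro X hX
    have h : LinearMap.adjoint (toEuclideanLin X) = toEuclideanLin X := by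
      rw [← toEuclideanLin_conjTranspose_eq_adjoint, hX.eq]
    rw [supp, LinearMap.orthogonal_ker, h]
  rw [hmem hN, supp, Submodule.isOrtho_comm, Submodule.IsOrtho, Submodule.orthogonal_orthogonal,
    LinearMap.range_le_ker_iff]
  constructor
  · intro h
    apply toEuclideanLin.injective
    rw [map_zero, ← h]
    ext v i
    simp [toLpLin_apply]
  · intro h
    ext v i
    simp [toLpLin_apply, h]

theorem isJordanHahn_iff {Δ P N : Matrix (Fin d) (Fin d) ℂ} :
    IsJordanHahn Δ P N ↔ Δ = P - N ∧ P.PosSemidef ∧ N.PosSemidef ∧ P * N = 0 := by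
  constructor
  · rintro ⟨h, hP, hN, ho⟩
    exact ⟨h, hP, hN, (supp_isOrtho_iff hN.isHermitian).1 ho⟩
  · rintro ⟨h, hP, hN, ho⟩
    exact ⟨h, hP, hN, (supp_isOrtho_iff hN.isHermitian).2 ho⟩

theorem cfc_sqrt_mul_self {A : Matrix (Fin d) (Fin d) ℂ} (hA : A.PosSemidef) :
    cfc Real.sqrt (A * A) = A := by
  obtain ⟨U, hU, x, hx, rfl⟩ := hA.exists_eq_mul_diagonal_mul
  have hU1 : Uᴴ * U = 1 := mem_unitaryGroup_iff'.1 hU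
  have he : U * (diagonal fun i => (x i : ℂ)) * Uᴴ * (U * (diagonal fun i => (x i : ℂ)) * Uᴴ)
      = U * (diagonal fun i => ((x i * x i : ℝ) : ℂ)) * Uᴴ := by
    calc _ = U * (diagonal fun i => (x i : ℂ)) * (Uᴴ * U) *
          (diagonal fun i => (x i : ℂ)) * Uᴴ := by simp only [Matrix.mul_assoc]
      _ = _ := by rw [hU1, Matrix.mul_one, Matrix.mul_assoc U, diagonal_mul_diagonal]; simp
  rw [he, cfc_mul_diagonal_mul_conjTranspose hU]
  simp only [Real.sqrt_mul_self (hx _)]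

theorem IsJordanHahn.cfc_sqrt {Δ P N : Matrix (Fin d) (Fin d) ℂ} (h : IsJordanHahn Δ P N) :
    cfc Real.sqrt (Δᴴ * Δ) = P + N := by
  obtain ⟨rfl, hP, hN, hPN⟩ := isJordanHahn_iff.1 h
  have hNP : N * P = 0 := by
    have := congrArg conjTranspose hPN
    rwa [conjTranspose_mul, hP.isHermitian.eq, hN.isHermitian.eq, conjTranspose_zero] at this
  rw [← cfc_sqrt_mul_self (hP.add hN), (hP.isHermitian.sub hN.isHermitian).eq]
  congr 1
  simp [Matrix.mul_add, Matrix.add_mul, Matrix.mul_sub, Matrix.sub_mul, hPN, hNP]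

/-- Both P - N = Δ and P + N = |Δ| are determined by Δ. -/
theorem IsJordanHahn.unique {Δ P N P' N' : Matrix (Fin d) (Fin d) ℂ} (h : IsJordanHahn Δ P N)
    (h' : IsJordanHahn Δ P' N') : P = P' ∧ N = N' := by
  have h1 : P - N = P' - N' := h.1.symm.trans h'.1
  have h2 : P + N = P' + N' := h.cfc_sqrt.symm.trans h'.cfc_sqrt
  have h3 : (2 : ℂ) • P = (2 : ℂ) • P' := by
    rw [two_smul, two_smul]
    calc P + P = (P + N) + (P - N) := by abel
      _ = P' + P' := by rw [h1, h2]; abel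
  have h4 : P = P' := smul_right_injective _ (two_ne_zero' ℂ) h3
  exact ⟨h4, by rw [h4] at h2; exact add_left_cancel h2⟩

open scoped MatrixOrder in
theorem exists_isJordanHahn {Δ : Matrix (Fin d) (Fin d) ℂ} (hΔ : Δ.IsHermitian) :
    ∃ P N, IsJordanHahn Δ P N := by
  have hsa : IsSelfAdjoint Δ := hΔ
  refine ⟨Δ⁺, Δ⁻, isJordanHahn_iff.2 ⟨(CFC.posPart_sub_negPart Δ hsa).symm, ?_, ?_, ?_⟩⟩
  · exact nonneg_iff_posSemidef.1 (CFC.posPart_nonneg Δ)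
  · exact nonneg_iff_posSemidef.1 (CFC.negPart_nonneg Δ)
  · exact CFC.posPart_mul_negPart Δ

end QEntropy

/-! ### From the bound to Audenaert–Fannes -/

/-- Gibbs' inequality against the uniform weight 1/k; the correction 1/k - x cancels when summed
over k weights of total 1. -/
theorem negMulLog_le_mul_log_add {x k : ℝ} (hx : 0 ≤ x) (hk : 0 < k) :
    Real.negMulLog x ≤ x * Real.log k + 1 / k - x := by
  rcases hx.eq_or_lt with rfl | hx
  · simp [hk.le]
  have h := mul_le_mul_of_nonneg_left
    (Real.log_le_sub_one_of_pos (x := 1 / (k * x)) (by positivity)) hx.le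
  rw [one_div, Real.log_inv, Real.log_mul hk.ne' hx.ne'] at h
  have e : x * ((k * x)⁻¹ - 1) = 1 / k - x := by field_simp
  rw [e] at h
  simp only [Real.negMulLog]
  linarith

namespace QEntropy

variable {d : ℕ}

theorem IsState.vonNeumannEntropy_nonneg {ρ : Matrix (Fin d) (Fin d) ℂ} (hρ : IsState ρ) :
    0 ≤ vonNeumannEntropy ρ := by
  obtain ⟨x, hx, hS, ht, -⟩ := exists_spectrum hρ.1
  rw [hρ.2, Complex.one_re] at ht
  rw [hS]
  refine Finset.sum_nonneg fun i _ => Real.negMulLog_nonneg (hx i) ?_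
  rw [← ht]
  exact Finset.single_le_sum (fun j _ => hx j) (Finset.mem_univ i)

theorem IsState.vonNeumannEntropy_le_log_of_det_eq_zero {ρ : Matrix (Fin d) (Fin d) ℂ}
    (hρ : IsState ρ) (hdet : ρ.det = 0) : vonNeumannEntropy ρ ≤ Real.log ((d : ℝ) - 1) := by
  obtain ⟨hpos, htr⟩ := hρ
  obtain ⟨U, hU, x, hx, rfl⟩ := hpos.exists_eq_mul_diagonal_mul
  rw [trace_mul_mul_conjTranspose hU, trace_diagonal, ← Complex.ofReal_sum] at htr
  have ht : ∑ i, x i = 1 := by exact_mod_cast htr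
  have hU2 : U * Uᴴ = 1 := mem_unitaryGroup_iff.1 hU
  rw [det_mul_right_comm, hU2, Matrix.one_mul, det_diagonal, Finset.prod_eq_zero_iff] at hdet
  obtain ⟨j, -, hj⟩ := hdet
  have hj : x j = 0 := by exact_mod_cast hj
  have ht' : ∑ i ∈ Finset.univ.erase j, x i = 1 := by
    rw [Finset.sum_erase _ hj, ht]
  have hcard : ((Finset.univ.erase j).card : ℝ) = (d : ℝ) - 1 := by
    rw [Finset.cast_card_erase_of_mem (Finset.mem_univ j)]; simp
  -- The remaining eigenvalues sum to 1, so at least one remains; this excludes d = 1.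
  have hk : 0 < (d : ℝ) - 1 := by
    rw [← hcard, Nat.cast_pos, Finset.card_pos]
    exact Finset.nonempty_of_sum_ne_zero (f := x) (by rw [ht']; exact one_ne_zero)
  rw [vonNeumannEntropy_mul_diagonal_mul hU,
    ← Finset.sum_erase Finset.univ (a := j) (by simp [hj])]
  calc _ ≤ ∑ i ∈ Finset.univ.erase j, (x i * Real.log ((d : ℝ) - 1) + 1 / ((d : ℝ) - 1) - x i) :=
        Finset.sum_le_sum fun i _ => negMulLog_le_mul_log_add (hx i) hk
    _ = _ := by
        rw [Finset.sum_sub_distrib, Finset.sum_add_distrib, ← Finset.sum_mul, ht',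
          Finset.sum_const, nsmul_eq_mul, hcard]
        field_simp
        ring

theorem IsJordanHahn.traceDist_eq {ρ₁ ρ₂ P N : Matrix (Fin d) (Fin d) ℂ}
    (h : IsJordanHahn (ρ₁ - ρ₂) P N) :
    traceDist ρ₁ ρ₂ = (1 / 2) * (P.trace.re + N.trace.re) := by
  rw [traceDist, traceNorm, h.cfc_sqrt, trace_add, Complex.add_re]

theorem IsJordanHahn.isState {ρ₁ ρ₂ σp σm : Matrix (Fin d) (Fin d) ℂ} {ε : ℝ} (hε₀ : 0 < ε)
    (h₁ : IsState ρ₁) (h₂ : IsState ρ₂) (hdist : traceDist ρ₁ ρ₂ = ε)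
    (h : IsJordanHahn (ρ₁ - ρ₂) (ε • σp) (ε • σm)) : IsState σp ∧ IsState σm := by
  have hpos : ∀ {σ : Matrix (Fin d) (Fin d) ℂ}, (ε • σ).PosSemidef → σ.PosSemidef := by
    intro σ hσ
    have := hσ.smul (inv_nonneg.2 hε₀.le)
    rwa [smul_smul, inv_mul_cancel₀ hε₀.ne', one_smul] at this
  have hp := hpos h.2.1
  have hm := hpos h.2.2.1
  have hre : ∀ {σ : Matrix (Fin d) (Fin d) ℂ}, σ.PosSemidef → σ.trace.re = 1 → σ.trace = 1 := by
    intro σ hσ hr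
    exact Complex.ext hr (by simpa using (Complex.nonneg_iff.1 hσ.trace_nonneg).2.symm)
  have e1 := h.traceDist_eq
  have e2 := congrArg Complex.re (congrArg trace h.1)
  rw [hdist] at e1
  simp only [trace_sub, h₁.2, h₂.2, trace_smul, sub_self, Complex.zero_re, Complex.sub_re,
    Complex.smul_re, smul_eq_mul] at e1 e2
  have e3 : σp.trace.re = σm.trace.re := mul_left_cancel₀ hε₀.ne' (by linarith)
  have e4 : σp.trace.re = 1 := mul_left_cancel₀ hε₀.ne' (by rw [← e3] at e1; linarith)
  exact ⟨⟨hp, hre hp e4⟩, ⟨hm, hre hm (e3 ▸ e4)⟩⟩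

theorem IsJordanHahn.mul_eq_zero {Δ σp σm : Matrix (Fin d) (Fin d) ℂ} {ε : ℝ} (hε₀ : 0 < ε)
    (h : IsJordanHahn Δ (ε • σp) (ε • σm)) : σp * σm = 0 := by
  have := (isJordanHahn_iff.1 h).2.2.2
  simpa [smul_smul, hε₀.ne'] using this

theorem IsJordanHahn.entropy_sub_le {ρ₁ ρ₂ σp σm : Matrix (Fin d) (Fin d) ℂ} {ε : ℝ}
    (hε₀ : 0 < ε) (hε₁ : ε < 1) (h₁ : IsState ρ₁) (h₂ : IsState ρ₂) (hdist : traceDist ρ₁ ρ₂ = ε)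
    (h : IsJordanHahn (ρ₁ - ρ₂) (ε • σp) (ε • σm)) :
    vonNeumannEntropy ρ₁ - vonNeumannEntropy ρ₂
      ≤ ε * vonNeumannEntropy σp - ε * vonNeumannEntropy σm + Real.binEntropy ε := by
  obtain ⟨hp, hm⟩ := h.isState hε₀ h₁ h₂ hdist
  obtain ⟨hΔ, hP, hN, hPN⟩ := isJordanHahn_iff.1 h
  have hsum : ρ₁ + ε • σm = ρ₂ + ε • σp := by
    rw [sub_eq_sub_iff_add_eq_add] at hΔ
    rw [hΔ, add_comm]
  have := entropy_bound_of_add_eq_add hε₀ hε₁ h₁.1 h₂.1 hP hN hsum hPN (by simp [h₂.2])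
    (by simp [trace_smul, hm.2])
  rw [vonNeumannEntropy_smul hp.1, vonNeumannEntropy_smul hm.1, hp.2, hm.2] at this
  linarith

theorem existsUnique_isJordanHahn {Δ : Matrix (Fin d) (Fin d) ℂ} (hΔ : Δ.IsHermitian) {ε : ℝ}
    (hε : ε ≠ 0) : ∃! σ : Matrix (Fin d) (Fin d) ℂ × Matrix (Fin d) (Fin d) ℂ,
      IsJordanHahn Δ (ε • σ.1) (ε • σ.2) := by
  obtain ⟨P, N, h⟩ := exists_isJordanHahn hΔ
  refine ⟨(ε⁻¹ • P, ε⁻¹ • N), by simpa [smul_smul, hε] using h, fun σ hσ => ?_⟩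
  obtain ⟨hP, hN⟩ := h.unique hσ
  exact Prod.ext (by simp [hP, smul_smul, hε]) (by simp [hN, smul_smul, hε])

theorem IsState.entropy_sub_le_log {ρ₁ ρ₂ : Matrix (Fin d) (Fin d) ℂ} {ε : ℝ}
    (hε₀ : 0 < ε) (hε₁ : ε < 1) (h₁ : IsState ρ₁) (h₂ : IsState ρ₂)
    (hdist : traceDist ρ₁ ρ₂ = ε) :
    vonNeumannEntropy ρ₁ - vonNeumannEntropy ρ₂
      ≤ ε * Real.log ((d : ℝ) - 1) + Real.binEntropy ε := by
  obtain ⟨⟨σp, σm⟩, h, -⟩ := existsUnique_isJordanHahn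
    (h₁.1.isHermitian.sub h₂.1.isHermitian) hε₀.ne'
  obtain ⟨hp, hm⟩ := h.isState hε₀ h₁ h₂ hdist
  have hdet : σp.det = 0 := by
    by_contra hne
    have hz := h.mul_eq_zero hε₀
    have : σm = 0 := by
      rw [← Matrix.one_mul σm, ← nonsing_inv_mul σp (isUnit_iff_ne_zero.2 hne), Matrix.mul_assoc, hz,
        Matrix.mul_zero]
    have h1 := hm.2
    rw [this, trace_zero] at h1
    exact zero_ne_one h1
  have hle := h.entropy_sub_le hε₀ hε₁ h₁ h₂ hdist
  have h3 := mul_le_mul_of_nonneg_left (hp.vonNeumannEntropy_le_log_of_det_eq_zero hdet) hε₀.le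
  have h4 := mul_nonneg hε₀.le hm.vonNeumannEntropy_nonneg
  linarith

/-! ### Symmetry, tightness and the final assembly -/

theorem traceDist_comm (ρ₁ ρ₂ : Matrix (Fin d) (Fin d) ℂ) :
    traceDist ρ₁ ρ₂ = traceDist ρ₂ ρ₁ := by
  have : (ρ₁ - ρ₂)ᴴ * (ρ₁ - ρ₂) = (ρ₂ - ρ₁)ᴴ * (ρ₂ - ρ₁) := by
    rw [← neg_sub ρ₂ ρ₁, conjTranspose_neg, neg_mul_neg]
  rw [traceDist, traceDist, traceNorm, traceNorm, this]

theorem isState_diagonal {x : Fin d → ℝ} (hx : ∀ i, 0 ≤ x i) (hsum : ∑ i, x i = 1) :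
    IsState (diagonal fun i => (x i : ℂ)) :=
  ⟨PosSemidef.diagonal fun i => by simpa using hx i, by
    rw [trace_diagonal, ← Complex.ofReal_sum, hsum, Complex.ofReal_one]⟩

/-- The bound on the entropy difference is attained by the commuting states
`diag (1 - ε, ε, 0, …)` and `diag (1, 0, …)`. -/
theorem exists_entropy_sub_eq {ε : ℝ} (hε₀ : 0 < ε) (hε₁ : ε < 1) (hd : 2 ≤ d) :
    ∃ ρ₁ ρ₂ ρp ρm : Matrix (Fin d) (Fin d) ℂ,
      IsState ρ₁ ∧ IsState ρ₂ ∧ traceDist ρ₁ ρ₂ = ε ∧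
      IsJordanHahn (ρ₁ - ρ₂) (ε • ρp) (ε • ρm) ∧
      vonNeumannEntropy ρ₁ - vonNeumannEntropy ρ₂ =
        ε * vonNeumannEntropy ρp - ε * vonNeumannEntropy ρm + Real.binEntropy ε := by
  obtain ⟨k, rfl⟩ := Nat.exists_eq_add_of_le' hd
  let v : ℝ → ℝ → Fin (k + 2) → ℝ := fun a b => vecCons a (vecCons b 0)
  have hv : ∀ {a b : ℝ}, 0 ≤ a → 0 ≤ b → ∀ i, 0 ≤ v a b i := by
    intro a b ha hb i
    refine Fin.cases ha (fun i => Fin.cases hb (fun i => le_rfl) i) i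
  have hsum : ∀ a b : ℝ, ∑ i, v a b i = a + b := by
    intro a b
    simp [v, Fin.sum_univ_succ]
  have hS : ∀ a b : ℝ, ∑ i, Real.negMulLog (v a b i) = Real.negMulLog a + Real.negMulLog b := by
    intro a b
    simp [v, Fin.sum_univ_succ]
  have hp : IsState (diagonal fun i => (v 0 1 i : ℂ)) :=
    isState_diagonal (hv le_rfl zero_le_one) (by rw [hsum, zero_add])
  have hm : IsState (diagonal fun i => (v 1 0 i : ℂ)) :=
    isState_diagonal (hv zero_le_one le_rfl) (by rw [hsum, add_zero])
  have hJ : IsJordanHahn ((diagonal fun i => (v (1 - ε) ε i : ℂ)) - diagonal fun i => (v 1 0 i : ℂ))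
      (ε • diagonal fun i => (v 0 1 i : ℂ)) (ε • diagonal fun i => (v 1 0 i : ℂ)) := by
    refine isJordanHahn_iff.2 ⟨?_, hp.1.smul hε₀.le, hm.1.smul hε₀.le, ?_⟩
    · rw [← smul_sub, diagonal_sub, diagonal_sub, ← diagonal_smul]
      congr 1
      ext i
      refine Fin.cases ?_ (fun i => Fin.cases ?_ (fun i => ?_) i) i <;> simp [v]
    · rw [smul_mul_smul_comm, diagonal_mul_diagonal, ← diagonal_smul, ← diagonal_zero]
      congr 1
      ext i
      refine Fin.cases ?_ (fun i => Fin.cases ?_ (fun i => ?_) i) i <;> simp [v]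
  refine ⟨_, _, _, _, isState_diagonal (hv (by linarith) hε₀.le) (by rw [hsum]; ring), hm, ?_, hJ, ?_⟩
  · rw [hJ.traceDist_eq, trace_smul, trace_smul, hp.2, hm.2]
    simp
    ring
  · simp only [vonNeumannEntropy_diagonal, hS, Real.negMulLog_zero, Real.negMulLog_one]
    rw [Real.binEntropy_eq_negMulLog_add_negMulLog_one_sub]
    ring

end QEntropy

theorem theorem1 (d : ℕ) (ε : ℝ) (hε₀ : 0 < ε) (hε₁ : ε < 1) :
    -- existence and uniqueness of `ρ₊, ρ₋`, their properties, and the entropy bound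
    (∀ ρ₁ ρ₂ : Matrix (Fin d) (Fin d) ℂ, QEntropy.IsState ρ₁ → QEntropy.IsState ρ₂ →
      QEntropy.traceDist ρ₁ ρ₂ = ε →
      (∃! σ : Matrix (Fin d) (Fin d) ℂ × Matrix (Fin d) (Fin d) ℂ,
        QEntropy.IsJordanHahn (ρ₁ - ρ₂) (ε • σ.1) (ε • σ.2)) ∧
      (∀ ρp ρm : Matrix (Fin d) (Fin d) ℂ,
        QEntropy.IsJordanHahn (ρ₁ - ρ₂) (ε • ρp) (ε • ρm) →
        QEntropy.IsState ρp ∧ QEntropy.IsState ρm ∧ QEntropy.supp ρp ⟂ QEntropy.supp ρm ∧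
        QEntropy.vonNeumannEntropy ρ₁ - QEntropy.vonNeumannEntropy ρ₂ ≤
          ε * QEntropy.vonNeumannEntropy ρp - ε * QEntropy.vonNeumannEntropy ρm
            + Real.binEntropy ε)) ∧
    -- tightness: in every dimension `d ≥ 2` the bound is attained
    (2 ≤ d →
      ∃ ρ₁ ρ₂ ρp ρm : Matrix (Fin d) (Fin d) ℂ,
        QEntropy.IsState ρ₁ ∧ QEntropy.IsState ρ₂ ∧ QEntropy.traceDist ρ₁ ρ₂ = ε ∧
        QEntropy.IsJordanHahn (ρ₁ - ρ₂) (ε • ρp) (ε • ρm) ∧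
        QEntropy.vonNeumannEntropy ρ₁ - QEntropy.vonNeumannEntropy ρ₂ =
          ε * QEntropy.vonNeumannEntropy ρp - ε * QEntropy.vonNeumannEntropy ρm
            + Real.binEntropy ε) ∧
    -- the Audenaert–Fannes inequality
    (∀ ρ₁ ρ₂ : Matrix (Fin d) (Fin d) ℂ, QEntropy.IsState ρ₁ → QEntropy.IsState ρ₂ →
      QEntropy.traceDist ρ₁ ρ₂ = ε →
      |QEntropy.vonNeumannEntropy ρ₁ - QEntropy.vonNeumannEntropy ρ₂| ≤
        ε * Real.log ((d : ℝ) - 1) + Real.binEntropy ε) := by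
  refine ⟨fun ρ₁ ρ₂ h₁ h₂ hdist => ⟨?_, fun ρp ρm h => ?_⟩, fun hd => ?_,
    fun ρ₁ ρ₂ h₁ h₂ hdist => ?_⟩
  · exact QEntropy.existsUnique_isJordanHahn (h₁.1.isHermitian.sub h₂.1.isHermitian) hε₀.ne'
  · obtain ⟨hp, hm⟩ := h.isState hε₀ h₁ h₂ hdist
    exact ⟨hp, hm, (QEntropy.supp_isOrtho_iff hm.1.isHermitian).2 (h.mul_eq_zero hε₀),
      h.entropy_sub_le hε₀ hε₁ h₁ h₂ hdist⟩
  · exact QEntropy.exists_entropy_sub_eq hε₀ hε₁ hd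
  · rw [abs_sub_le_iff]
    exact ⟨h₁.entropy_sub_le_log hε₀ hε₁ h₂ hdist,
      h₂.entropy_sub_le_log hε₀ hε₁ h₁ (QEntropy.traceDist_comm ρ₂ ρ₁ ▸ hdist)⟩
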